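/- Let $n=p^t m$, where $p$ is an odd prime and $t\ge 1$, $m\ge 1$ are integers. Let $$T_{4n}=\langle a,b\mid a^{2n}=1,\ a^n=b^2,\ b^{-1}ab=a^{-1}\rangle$$ be the dicyclic group of order $4n$, and let $S=\{a^m,a^{-m}\}\cup\langle a\rangle b$. Let $\Gamma=\mathrm{Cay}(T_{4n},S)$ be the Cayley graph with vertex set $T_{4n}$ and edges $\{g,sg\}$ for $g\in T_{4n}$, $s\in S$, let $A$ be its adjacency matrix, and put $H(\tau)=\exp(\mathrm{i}\tau A)$ for $\tau\in\mathbb{R}$. Then $\Gamma$ admits pretty good fractional revival (PGFR); that is, there are two distinct vertices $u,v$ of $\Gamma$, a sequence $(\tau_k)$ of real numbers, and complex numbers $\alpha,\beta$ with $|\alpha|^2+|\beta|^2=1$ and $\beta\neq 0$ such that $$\lim_{k\to\infty}H(\tau_k)\,\mathbf{e}_u=\alpha\,\mathbf{e}_u+\beta\,\mathbf{e}_v,$$ where $\mathbf{e}_w$ denotes the standard basis vector of $\mathbb{C}^{T_{4n}}$ indexed by $w$. -/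

import Mathlib

open Filter Topology

noncomputable section

namespace PGFR

/-- The Cayley graph `Cay(G, S)`: the vertices are the elements of `G`, and the edges are the pairs
`{g, s * g}` with `g ∈ G` and `s ∈ S` (loops, which occur only if `1 ∈ S`, are discarded). -/
def cayleyGraph {G : Type*} [Group G] (S : Set G) : SimpleGraph G :=
  SimpleGraph.fromRel fun g h => ∃ s ∈ S, h = s * g

/-- For an inverse-closed connection set without the identity, adjacency is the usual one. -/
theorem cayleyGraph_adj {G : Type*} [Group G] {S : Set G} (h1 : (1 : G) ∉ S)
    (hS : ∀ s ∈ S, s⁻¹ ∈ S) (g h : G) :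
    (cayleyGraph S).Adj g h ↔ ∃ s ∈ S, h = s * g := by
  unfold cayleyGraph
  rw [SimpleGraph.fromRel_adj]
  constructor
  · rintro ⟨-, h | ⟨s, hs, rfl⟩⟩
    · exact h
    · exact ⟨s⁻¹, hS s hs, by simp⟩
  · rintro ⟨s, hs, rfl⟩
    refine ⟨fun h => h1 ?_, Or.inl ⟨s, hs, rfl⟩⟩
    have : s = 1 := by simpa using h
    exact this ▸ hs

open Classical in
/-- The transition matrix `H(t) = exp(i t A)`, where `A` is the adjacency matrix of `Γ`. -/
def transitionMatrix {V : Type*} [Fintype V] (Γ : SimpleGraph V) (t : ℝ) : Matrix V V ℂ :=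
  NormedSpace.exp ((Complex.I * (t : ℂ)) • Γ.adjMatrix ℂ)

open Classical in
/-- `Γ` admits pretty good fractional revival from `u` to `v` (two distinct vertices): there are a
sequence of real times `τ k` and complex numbers `α`, `β` with `|α|² + |β|² = 1` and `β ≠ 0` such
that `H(τ k) e_u → α e_u + β e_v`. (For `β = 0` one speaks of approximate periodicity at `u`.) -/
def AdmitsPGFRFromTo {V : Type*} [Fintype V] (Γ : SimpleGraph V) (u v : V) : Prop :=
  u ≠ v ∧ ∃ (τ : ℕ → ℝ) (α β : ℂ), ‖α‖ ^ 2 + ‖β‖ ^ 2 = 1 ∧ β ≠ 0 ∧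
    Tendsto (fun k => (transitionMatrix Γ (τ k)).mulVec (Pi.single u 1)) atTop
      (𝓝 (α • Pi.single u 1 + β • Pi.single v 1 : V → ℂ))

/-- `Γ` admits pretty good fractional revival: it does so from some vertex to another one. -/
def AdmitsPGFR {V : Type*} [Fintype V] (Γ : SimpleGraph V) : Prop :=
  ∃ u v : V, AdmitsPGFRFromTo Γ u v

/-- The generator `a` of the dicyclic group
`T_{4n} = ⟨a, b | a ^ (2 n) = 1, a ^ n = b ^ 2, b⁻¹ a b = a⁻¹⟩`, which is `QuaternionGroup n`. -/
def genA (n : ℕ) : QuaternionGroup n := QuaternionGroup.a 1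

/-- The generator `b` of the dicyclic group `T_{4n}`. -/
def genB (n : ℕ) : QuaternionGroup n := QuaternionGroup.xa 0

/-- The connection set `S = {a ^ m, a ^ (-m)} ∪ ⟨a⟩ b` in `T_{4n}`. -/
def connectionSet (n m : ℕ) : Set (QuaternionGroup n) :=
  {genA n ^ m, (genA n ^ m)⁻¹} ∪
    {g | ∃ c ∈ Subgroup.zpowers (genA n), g = c * genB n}

end PGFR

end

/-! Put `q = p ^ t`. Each nontrivial character `j` of `⟨a⟩`, extended by zero, is an eigenvector
with eigenvalue `2 cos (π j / q)`. The trivial one is half the sum of two eigenvectors with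
eigenvalues `2 ± 2 n`. If times `τ` bring `exp (2 i τ cos (π j / q))` close to `exp (i (-1) ^ j φ) =
cos φ + i (-1) ^ j sin φ` for all `j`, and `exp (2 i n τ)` close to `1`, then, as `(-1) ^ j` is the
value of the character `j` at `a ^ n`, Fourier inversion on `⟨a⟩` sends `e_1` close to `cos φ e_1 +
i sin φ e_{a ^ n}`.

By Kronecker's theorem (`kronecker_approximation`) such times exist once every integral relation
among the frequencies is respected by the phases modulo `2 π`. With `η = -exp (π i / q)`, a
primitive `q`-th root of unity, `2 cos (π j / q) = (-1) ^ j (η ^ j + η ^ (-j))`. Modulo the prime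
above `p`, `η` becomes `1` and `2 n` vanishes, so a relation with coefficients `l j` forces `p ∣ ∑
(-1) ^ j l j`, since `p` is odd. Hence `φ = 2 π / p` is admissible, and `sin φ ≠ 0` because `p ≥ 3`.
-/

/-! ### Mean values of exponential sums and Kronecker's theorem -/

theorem tendsto_mean_cexp (μ : ℝ) :
    Tendsto (fun T : ℝ => (T : ℂ)⁻¹ * ∫ τ in (0 : ℝ)..T, Complex.exp (Complex.I * τ * μ)) atTop
      (𝓝 (if μ = 0 then 1 else 0)) := by
  split_ifs with h
  · refine tendsto_const_nhds.congr' ?_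
    filter_upwards [eventually_gt_atTop 0] with T hT
    have : (T : ℂ) ≠ 0 := by exact_mod_cast hT.ne'
    simp [h, this]
  · have hc : Complex.I * (μ : ℂ) ≠ 0 := by simp [h]
    have hI : ∀ T : ℝ, ∫ τ in (0 : ℝ)..T, Complex.exp (Complex.I * τ * μ) =
        (Complex.exp (Complex.I * μ * T) - 1) / (Complex.I * μ) := by
      intro T
      have := integral_exp_mul_complex (a := 0) (b := T) hc
      simp only [Complex.ofReal_zero, mul_zero, Complex.exp_zero] at this
      rw [← this]
      congr 1
      ext τ
      ring_nf
    simp_rw [hI]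
    rw [tendsto_zero_iff_norm_tendsto_zero]
    have hlim : Tendsto (fun T : ℝ => T⁻¹ * (2 / |μ|)) atTop (𝓝 0) := by
      simpa using tendsto_inv_atTop_zero.mul_const (2 / |μ|)
    refine squeeze_zero' (Eventually.of_forall fun _ => norm_nonneg _) ?_ hlim
    filter_upwards [eventually_gt_atTop 0] with T hT
    have h1 : ‖Complex.exp (Complex.I * μ * T) - 1‖ ≤ 2 := by
      refine (norm_sub_le _ _).trans ?_
      have : Complex.I * (μ : ℂ) * T = ((μ * T : ℝ) : ℂ) * Complex.I := by push_cast; ring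
      rw [this, Complex.norm_exp_ofReal_mul_I]
      norm_num
    rw [norm_mul, norm_div, norm_mul, norm_inv, Complex.norm_I, one_mul, Complex.norm_real,
      Complex.norm_real, Real.norm_eq_abs, Real.norm_eq_abs, abs_of_pos hT]
    gcongr

/-- The constant term of an exponential sum is bounded by the supremum of the sum. -/
theorem norm_sum_filter_le_of_norm_expSum_le {κ : Type*} (s : Finset κ) (c : κ → ℂ) (μ : κ → ℝ)
    (B : ℝ) (hB : ∀ τ : ℝ, ‖∑ k ∈ s, c k * Complex.exp (Complex.I * τ * μ k)‖ ≤ B) :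
    ‖∑ k ∈ s with μ k = 0, c k‖ ≤ B := by
  have hlim : Tendsto (fun T : ℝ => (T : ℂ)⁻¹ *
      ∫ τ in (0 : ℝ)..T, ∑ k ∈ s, c k * Complex.exp (Complex.I * τ * μ k)) atTop
      (𝓝 (∑ k ∈ s with μ k = 0, c k)) := by
    have h := tendsto_finsetSum s fun k _ => (tendsto_mean_cexp (μ k)).const_mul (c k)
    convert h using 2 with T
    · rw [intervalIntegral.integral_finsetSum, Finset.mul_sum]
      · refine Finset.sum_congr rfl fun k _ => ?_
        rw [intervalIntegral.integral_const_mul]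
        ring
      · intro k _
        apply Continuous.intervalIntegrable
        fun_prop
    · simp [Finset.sum_filter]
  refine le_of_tendsto hlim.norm ?_
  filter_upwards [eventually_gt_atTop 0] with T hT
  have h := intervalIntegral.norm_integral_le_of_norm_le_const (a := 0) (b := T)
    (f := fun τ : ℝ => ∑ k ∈ s, c k * Complex.exp (Complex.I * τ * μ k)) (C := B)
    fun τ _ => hB τ
  rw [sub_zero, abs_of_pos hT] at h
  rw [norm_mul, norm_inv, Complex.norm_real, Real.norm_eq_abs, abs_of_pos hT]
  rw [inv_mul_le_iff₀ hT]
  linarith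

section

variable {ι : Type*} [Fintype ι] [DecidableEq ι] {θ x : ι → ℝ}

/-- In the `N`-th power of the sum, rotated so that the term of `k` is constant with positive
coefficient, `hrel` makes every other constant term positive too. Nothing cancels, so the mean value
dominates the single coefficient of `k`. -/
theorem multinomial_le_pow_of_norm_expSum_le
    (hrel : ∀ l : ι → ℤ, ∑ i, (l i : ℝ) * θ i = 0 →
      Complex.exp (Complex.I * ∑ i, (l i : ℂ) * x i) = 1)
    {B : ℝ} (hB : ∀ τ : ℝ, ‖∑ i, Complex.exp (Complex.I * (τ * θ i - x i))‖ ≤ B)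
    (N : ℕ) {k : ι → ℕ} (hk : k ∈ Finset.piAntidiag Finset.univ N) :
    (Nat.multinomial Finset.univ k : ℝ) ≤ B ^ N := by
  set c : (ι → ℕ) → ℂ := fun k' => (Nat.multinomial Finset.univ k' : ℂ) *
    Complex.exp (Complex.I * ∑ i, ((k i : ℂ) - k' i) * x i)
  set μ : (ι → ℕ) → ℝ := fun k' => ∑ i, ((k' i : ℝ) - k i) * θ i
  have hnorm : ∀ τ : ℝ,
      ‖∑ k' ∈ Finset.piAntidiag Finset.univ N, c k' * Complex.exp (Complex.I * τ * μ k')‖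
        ≤ B ^ N := by
    intro τ
    have hF : ∑ k' ∈ Finset.piAntidiag Finset.univ N, c k' * Complex.exp (Complex.I * τ * μ k')
        = Complex.exp (((∑ i, (k i : ℝ) * (x i - τ * θ i) : ℝ) : ℂ) * Complex.I) *
          (∑ i, Complex.exp (Complex.I * (τ * θ i - x i))) ^ N := by
      rw [Finset.sum_pow_eq_sum_piAntidiag, Finset.mul_sum]
      refine Finset.sum_congr rfl fun k' _ => ?_
      simp only [c, μ, ← Complex.exp_nat_mul, ← Complex.exp_sum]
      rw [mul_assoc, ← Complex.exp_add, mul_left_comm, ← Complex.exp_add]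
      congr 2
      push_cast
      simp only [Finset.mul_sum, Finset.sum_mul, ← Finset.sum_add_distrib]
      refine Finset.sum_congr rfl fun i _ => ?_
      ring
    rw [hF, norm_mul, Complex.norm_exp_ofReal_mul_I, one_mul, norm_pow]
    exact pow_le_pow_left₀ (norm_nonneg _) (hB τ) N
  have h := norm_sum_filter_le_of_norm_expSum_le _ c μ _ hnorm
  have hc : ∀ k' ∈ (Finset.piAntidiag Finset.univ N).filter (fun k' => μ k' = 0),
      c k' = (Nat.multinomial Finset.univ k' : ℂ) := by
    intro k' hk'
    have hμ := (Finset.mem_filter.1 hk').2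
    have := hrel (fun i => (k i : ℤ) - k' i) (by
      rw [← neg_eq_zero, ← hμ, ← Finset.sum_neg_distrib]
      refine Finset.sum_congr rfl fun i _ => ?_
      push_cast
      ring)
    push_cast at this
    simp only [c, this, mul_one]
  rw [Finset.sum_congr rfl hc, ← Nat.cast_sum, Complex.norm_natCast] at h
  refine le_trans ?_ h
  exact_mod_cast Finset.single_le_sum (f := fun k' => Nat.multinomial Finset.univ k')
    (fun _ _ => Nat.zero_le _) (Finset.mem_filter.2 ⟨hk, by simp [μ]⟩)

/-- The multinomial coefficients of degree `N` add up to `r ^ N`, but only polynomially many occur.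
If each were at most `C ^ N` with `C < r`, exponential growth would give a contradiction. -/
theorem exists_norm_expSum_gt [Nonempty ι]
    (hrel : ∀ l : ι → ℤ, ∑ i, (l i : ℝ) * θ i = 0 →
      Complex.exp (Complex.I * ∑ i, (l i : ℂ) * x i) = 1)
    {B : ℝ} (hB : B < Fintype.card ι) :
    ∃ τ : ℝ, B < ‖∑ i, Complex.exp (Complex.I * (τ * θ i - x i))‖ := by
  by_contra! hcon
  set r : ℝ := (Fintype.card ι : ℝ) with hrdef
  have hr : 0 < r := by simp [r, Fintype.card_pos]
  -- The maximum with `r / 2` only serves to make the bound positive.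
  set C : ℝ := max B (r / 2)
  have hC : 0 < C := lt_max_of_lt_right (by positivity)
  have hCr : C < r := max_lt hB (by linarith)
  have hbound : ∀ N : ℕ, r ^ N ≤ ((N : ℝ) + 1) ^ Fintype.card ι * C ^ N := by
    intro N
    have h1 : r ^ N = ∑ k ∈ Finset.piAntidiag (Finset.univ : Finset ι) N,
        (Nat.multinomial Finset.univ k : ℝ) := by
      have := Finset.sum_pow_eq_sum_piAntidiag (Finset.univ : Finset ι) (fun _ => (1 : ℝ)) N
      simpa [r] using this
    have hcard : (Finset.piAntidiag (Finset.univ : Finset ι) N).card ≤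
        (N + 1) ^ Fintype.card ι := by
      have hsub : Finset.piAntidiag (Finset.univ : Finset ι) N ⊆
          Fintype.piFinset fun _ => Finset.range (N + 1) := by
        intro k hk
        rw [Finset.mem_piAntidiag] at hk
        rw [Fintype.mem_piFinset]
        intro i
        rw [Finset.mem_range, Nat.lt_succ_iff, ← hk.1]
        exact Finset.single_le_sum (fun _ _ => Nat.zero_le _) (Finset.mem_univ i)
      simpa using Finset.card_le_card hsub
    rw [h1]
    refine (Finset.sum_le_card_nsmul _ _ (C ^ N) fun k hk =>
      multinomial_le_pow_of_norm_expSum_le hrel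
        (fun τ => (hcon τ).trans (le_max_left _ _)) N hk).trans ?_
    rw [nsmul_eq_mul]
    gcongr
    exact_mod_cast hcard
  have hq : |C / r| < 1 := by
    rw [abs_of_pos (by positivity)]
    exact (div_lt_one hr).2 hCr
  have hlim := (tendsto_pow_const_mul_const_pow_of_abs_lt_one (Fintype.card ι) hq).comp
    (tendsto_add_atTop_nat 1)
  -- Term `N + 1` of the null sequence is `C / r` times a quantity that `hbound` shows to be at
  -- least `1`.
  have hge : C / r ≤ 0 := by
    refine ge_of_tendsto' hlim fun N => ?_
    have h2 : 1 ≤ ((N : ℝ) + 1) ^ Fintype.card ι * (C / r) ^ N := by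
      rw [div_pow, ← mul_div_assoc, one_le_div (by positivity)]
      exact hbound N
    simp only [Function.comp_apply, Nat.cast_add, Nat.cast_one, pow_succ]
    rw [← mul_assoc]
    exact le_mul_of_one_le_left (by positivity) h2
  exact absurd hge (not_le.2 (by positivity))

/-- **Kronecker's approximation theorem**, in the presence of an index `o` of frequency zero. -/
theorem kronecker_approximation {o : ι} (hθ : θ o = 0) (hx : x o = 0)
    (hrel : ∀ l : ι → ℤ, ∑ i, (l i : ℝ) * θ i = 0 →
      Complex.exp (Complex.I * ∑ i, (l i : ℂ) * x i) = 1)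
    {ε : ℝ} (hε : 0 < ε) :
    ∃ τ : ℝ, ∀ i, ‖Complex.exp (Complex.I * (τ * θ i)) - Complex.exp (Complex.I * x i)‖ < ε := by
  have : Nonempty ι := ⟨o⟩
  -- Below, `‖1 + w i‖ > 2 - δ` and the parallelogram law give `‖1 - w i‖ ^ 2 < 4 - (2 - δ) ^ 2 ≤ 4
  -- * δ`.
  obtain ⟨δ, hδ0, hδ⟩ : ∃ δ : ℝ, 0 < δ ∧ 4 * δ ≤ ε ^ 2 / 2 ∧ δ ≤ 1 := by
    refine ⟨min (ε ^ 2 / 8) 1, by positivity, ?_, min_le_right _ _⟩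
    linarith [min_le_left (ε ^ 2 / 8) 1]
  obtain ⟨τ, hτ⟩ := exists_norm_expSum_gt hrel (B := Fintype.card ι - δ) (by linarith)
  refine ⟨τ, fun i => ?_⟩
  set w : ι → ℂ := fun i => Complex.exp (Complex.I * (τ * θ i - x i)) with hw
  have hw1 : ∀ i, ‖w i‖ = 1 := by
    intro i
    have : Complex.I * ((τ : ℂ) * θ i - x i) = ((τ * θ i - x i : ℝ) : ℂ) * Complex.I := by
      push_cast; ring
    simp only [w, this, Complex.norm_exp_ofReal_mul_I]
  -- A nearly maximal sum aligns the `w i` only up to a common rotation; the index `o` pins that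
  -- rotation to `1`.
  have hwo : w o = 1 := by simp [w, hθ, hx]
  have hdist : ‖Complex.exp (Complex.I * (τ * θ i)) - Complex.exp (Complex.I * x i)‖
      = ‖1 - w i‖ := by
    have h1 : Complex.exp (Complex.I * (τ * θ i)) = Complex.exp ((x i : ℂ) * Complex.I) * w i := by
      simp only [w, ← Complex.exp_add]
      ring_nf
    have h2 : Complex.exp (Complex.I * x i) = Complex.exp ((x i : ℂ) * Complex.I) := by
      rw [mul_comm]
    rw [h1, h2, ← mul_sub_one, norm_mul, Complex.norm_exp_ofReal_mul_I, one_mul, norm_sub_rev]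
  rw [hdist]
  by_cases hio : i = o
  · rw [hio, hwo, sub_self, norm_zero]
    exact hε
  have hsum : 2 - δ < ‖1 + w i‖ := by
    have hsplit : ∑ j, w j = (1 + w i) + ∑ j ∈ (Finset.univ.erase o).erase i, w j := by
      rw [← Finset.add_sum_erase _ _ (Finset.mem_univ o),
        ← Finset.add_sum_erase _ _ (Finset.mem_erase.2 ⟨hio, Finset.mem_univ i⟩), hwo, add_assoc]
    have hrest : ‖∑ j ∈ (Finset.univ.erase o).erase i, w j‖ ≤ Fintype.card ι - 2 := by
      refine (norm_sum_le _ _).trans ?_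
      have h3 : 2 ≤ Fintype.card ι := by
        rw [Nat.succ_le_iff, Fintype.one_lt_card_iff]
        exact ⟨i, o, hio⟩
      simp only [hw1, Finset.sum_const, nsmul_eq_mul, mul_one]
      rw [Finset.card_erase_of_mem (Finset.mem_erase.2 ⟨hio, Finset.mem_univ i⟩),
        Finset.card_erase_of_mem (Finset.mem_univ o), Finset.card_univ, Nat.sub_sub,
        Nat.cast_sub h3]
      norm_num
    have := norm_add_le (1 + w i) (∑ j ∈ (Finset.univ.erase o).erase i, w j)
    rw [← hsplit] at this
    linarith
  have hpar := parallelogram_law_with_norm ℝ (1 : ℂ) (w i)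
  rw [hw1, norm_one] at hpar
  refine lt_of_pow_lt_pow_left₀ 2 hε.le ?_
  nlinarith [sq_pos_of_pos hε, hδ.1, hδ.2]

end

/-! ### Reduction modulo the prime above `p` -/

/-- An integral linear relation among the `ζ ^ k + ζ ^ (-k)` and `p` holds modulo the prime
above `p`, where `ζ` becomes `1`. -/
theorem IsPrimitiveRoot.dvd_sum_of_sum_add_inv_eq_zero {ι : Type*} [Fintype ι] {p t : ℕ}
    (hp : p.Prime) (hodd : Odd p) (ht : 1 ≤ t) {η : ℂ} (hη : IsPrimitiveRoot η (p ^ t))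
    (e : ι → ℕ) (l : ι → ℤ) {c : ℤ} (hc : (p : ℤ) ∣ c)
    (h : ∑ i, (l i : ℂ) * (η ^ e i + (η ^ e i)⁻¹) + c = 0) :
    (p : ℤ) ∣ ∑ i, l i := by
  have := Fact.mk hp
  have hq : 0 < p ^ t := pow_pos hp.pos t
  -- The exponent `(p ^ t - 1) * e i` stands for `-e i`. The cyclotomic polynomial divides `P` and
  -- takes the value `p` at `1`, so `p` divides `P(1)`.
  set P : Polynomial ℤ := ∑ i, Polynomial.C (l i) *
    (Polynomial.X ^ e i + Polynomial.X ^ ((p ^ t - 1) * e i)) + Polynomial.C c with hP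
  have hinv : ∀ k : ℕ, η ^ ((p ^ t - 1) * k) = (η ^ k)⁻¹ := by
    intro k
    refine eq_inv_of_mul_eq_one_left ?_
    rw [← pow_add, ← Nat.succ_mul, Nat.succ_eq_add_one, Nat.sub_add_cancel hq, pow_mul,
      hη.pow_eq_one, one_pow]
  have hroot : Polynomial.aeval η P = 0 := by
    simpa [hP, hinv] using h
  have hdvd : Polynomial.cyclotomic (p ^ t) ℤ ∣ P := by
    rw [Polynomial.cyclotomic_eq_minpoly hη hq]
    exact minpoly.isIntegrallyClosed_dvd (hη.isIntegral hq) hroot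
  obtain ⟨s, rfl⟩ : ∃ s, t = s + 1 := ⟨t - 1, by omega⟩
  have heval := Polynomial.eval_dvd (x := 1) hdvd
  rw [Polynomial.eval_one_cyclotomic_prime_pow] at heval
  have hP1 : P.eval 1 = 2 * ∑ i, l i + c := by
    simp [hP, Polynomial.eval_finsetSum, ← Finset.sum_mul, mul_comm, one_add_one_eq_two]
  rw [hP1, dvd_add_left hc] at heval
  have hcop : IsCoprime (p : ℤ) 2 := by
    exact_mod_cast Nat.isCoprime_iff_coprime.2 hodd.coprime_two_right
  exact hcop.dvd_of_dvd_mul_left heval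

/-! ### Matrix exponentials on eigenvectors -/

open scoped Matrix.Norms.Operator in
theorem Matrix.exp_mulVec_of_mulVec_eq_smul {V : Type*} [Fintype V] [DecidableEq V]
    {M : Matrix V V ℂ} {v : V → ℂ} {c : ℂ} (h : M.mulVec v = c • v) :
    (NormedSpace.exp M).mulVec v = Complex.exp c • v := by
  have hpow : ∀ k : ℕ, (M ^ k).mulVec v = c ^ k • v := by
    intro k
    induction k with
    | zero => simp
    | succ k ih => rw [pow_succ, ← Matrix.mulVec_mulVec, h, Matrix.mulVec_smul, ih, smul_smul,
        pow_succ, mul_comm]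
  have hM := NormedSpace.exp_series_hasSum_exp' (𝕂 := ℂ) M
  have hc := NormedSpace.exp_series_hasSum_exp' (𝕂 := ℂ) c
  rw [← Complex.exp_eq_exp_ℂ] at hc
  ext i
  have hcont : Continuous fun N : Matrix V V ℂ => (N.mulVec v) i := by
    fun_prop
  have h1 : HasSum (fun k : ℕ => (((k.factorial : ℂ)⁻¹ • M ^ k).mulVec v) i)
      (((NormedSpace.exp M).mulVec v) i) := hM.map
    ({toFun := fun N : Matrix V V ℂ => (N.mulVec v) i
      map_zero' := by simp
      map_add' := fun _ _ => by simp [Matrix.add_mulVec] } : Matrix V V ℂ →+ ℂ) hcont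
  have h2 := hc.mul_right (v i)
  simp only [Matrix.smul_mulVec, hpow, Pi.smul_apply, smul_eq_mul, ← mul_assoc] at h1 h2
  exact h1.unique h2

/-! ### Fourier analysis on the dicyclic group -/

namespace QuaternionGroup

variable {n : ℕ}

/-- The dicyclic group is the disjoint union of `⟨a⟩` and `x⟨a⟩`. -/
def sumEquiv (n : ℕ) : ZMod (2 * n) ⊕ ZMod (2 * n) ≃ QuaternionGroup n where
  toFun := Sum.elim a xa
  invFun
    | a j => Sum.inl j
    | xa j => Sum.inr j
  left_inv := by rintro (x | x) <;> rfl
  right_inv := by rintro (x | x) <;> rfl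

theorem sum_eq [NeZero n] (f : QuaternionGroup n → ℂ) :
    ∑ g, f g = ∑ i, f (a i) + ∑ i, f (xa i) := by
  rw [← (sumEquiv n).sum_comp, Fintype.sum_sum_type]
  rfl

/-- The character `a ^ x ↦ exp (π i j x / n)` of `⟨a⟩`, extended by zero. -/
noncomputable def charVec [NeZero n] (j : ZMod (2 * n)) : QuaternionGroup n → ℂ
  | a x => ZMod.stdAddChar (x * j)
  | xa _ => 0

/-- The function with value `1` on `⟨a⟩` and `c` off `⟨a⟩`. -/
def cosetVec (c : ℂ) : QuaternionGroup n → ℂ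
  | a _ => 1
  | xa _ => c

theorem sum_stdAddChar_smul_charVec [NeZero n] (y : ZMod (2 * n))
    [DecidableEq (QuaternionGroup n)] :
    (2 * n : ℂ)⁻¹ • ∑ j, ZMod.stdAddChar (y * j) • charVec j = Pi.single (a (-y)) (1 : ℂ) := by
  have hn : (2 * n : ℂ) ≠ 0 := by simp [NeZero.ne n]
  ext (x | x)
  · have h : ∀ j, (ZMod.stdAddChar (y * j) : ℂ) * ZMod.stdAddChar (x * j) =
        ZMod.stdAddChar (j * (x + y)) := by
      intro j
      rw [← AddChar.map_add_eq_mul]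
      ring_nf
    simp only [Pi.smul_apply, Finset.sum_apply, charVec, smul_eq_mul, h, Pi.single_apply, a.injEq]
    rw [AddChar.sum_mulShift _ (ZMod.isPrimitive_stdAddChar _), ZMod.card]
    by_cases hxy : x = -y
    · simp only [hxy, neg_add_cancel, if_true]
      push_cast
      exact inv_mul_cancel₀ hn
    · have : x + y ≠ 0 := fun h => hxy (eq_neg_of_add_eq_zero_left h)
      simp [hxy, this]
  · simp [charVec]

/-- The trivial character extended by zero is not an eigenvector; for `c = 1` this splits it into
two that are. -/
theorem cosetVec_add_cosetVec_neg [NeZero n] (c : ℂ) :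
    cosetVec c + cosetVec (-c) = (2 : ℂ) • charVec (0 : ZMod (2 * n)) := by
  ext (x | x) <;> simp [cosetVec, charVec, one_add_one_eq_two]

end QuaternionGroup

/-! ### Spectrum of the Cayley graph -/

namespace PGFR

open QuaternionGroup

variable {n m : ℕ}

theorem natCast_add_natCast_self (n : ℕ) : (n : ZMod (2 * n)) + n = 0 := by
  have h : ((n + n : ℕ) : ZMod (2 * n)) = 0 :=
    (ZMod.natCast_eq_zero_iff _ _).2 (dvd_of_eq (two_mul n))
  exact_mod_cast h

theorem a_mem_connectionSet {i : ZMod (2 * n)} :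
    a i ∈ connectionSet n m ↔ i = m ∨ i = -m := by
  have h : ∀ c ∈ Subgroup.zpowers (genA n), a i ≠ c * genB n := by
    rintro c ⟨k, rfl⟩
    have : ∃ y, genA n ^ k = a y := by
      have hk : ∀ k : ℤ, genA n ^ k = a (k : ZMod (2 * n)) := by
        intro k
        obtain ⟨k, rfl | rfl⟩ := k.eq_nat_or_neg
        · simp [genA]
        · simp only [genA, zpow_neg, zpow_natCast, a_one_pow, Int.cast_neg, Int.cast_natCast]
          rfl
      exact ⟨_, hk k⟩
    obtain ⟨y, hy⟩ := this
    simp [hy, genB]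
  have hinv : (a (m : ZMod (2 * n)) : QuaternionGroup n)⁻¹ = a (-m) := rfl
  constructor
  · rintro (h1 | ⟨c, hc, h1⟩)
    · simpa [genA, hinv] using h1
    · exact absurd h1 (h c hc)
  · intro h1
    left
    simpa [genA, hinv] using h1

theorem xa_mem_connectionSet [NeZero n] (i : ZMod (2 * n)) : xa i ∈ connectionSet n m := by
  right
  refine ⟨genA n ^ (-i).val, Subgroup.npow_mem_zpowers _ _, ?_⟩
  simp [genA, genB]

theorem cayleyGraph_connectionSet_adj [NeZero n] (hm : (m : ZMod (2 * n)) ≠ 0)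
    (g h : QuaternionGroup n) :
    (cayleyGraph (connectionSet n m)).Adj g h ↔ h * g⁻¹ ∈ connectionSet n m := by
  rw [cayleyGraph_adj]
  · constructor
    · rintro ⟨s, hs, rfl⟩
      simpa using hs
    · intro hs
      exact ⟨_, hs, by simp⟩
  · rw [one_def, a_mem_connectionSet]
    rintro (h | h)
    · exact hm h.symm
    · exact hm (neg_eq_zero.1 h.symm)
  · rintro (i | i) hs
    · have : (a i : QuaternionGroup n)⁻¹ = a (-i) := rfl
      rw [a_mem_connectionSet] at hs
      rw [this, a_mem_connectionSet, neg_inj, neg_eq_iff_eq_neg]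
      exact hs.symm
    · exact xa_mem_connectionSet _

open Classical in
theorem adjMatrix_mulVec [NeZero n] (hm : (m : ZMod (2 * n)) ≠ 0)
    (hm2 : (m : ZMod (2 * n)) ≠ -m) (f : QuaternionGroup n → ℂ) :
    (∀ i, ((cayleyGraph (connectionSet n m)).adjMatrix ℂ).mulVec f (a i) =
      f (a (i + m)) + f (a (i - m)) + ∑ j, f (xa j)) ∧
    ∀ i, ((cayleyGraph (connectionSet n m)).adjMatrix ℂ).mulVec f (xa i) =
      f (xa (i + m)) + f (xa (i - m)) + ∑ j, f (a j) := by
  have key : ∀ (i : ZMod (2 * n)) (F : ZMod (2 * n) → ℂ),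
      ∑ j, (if j - i = m ∨ j - i = -m then F j else 0) = F (i + m) + F (i - m) := by
    intro i F
    have : ∀ j, (if j - i = m ∨ j - i = -m then F j else 0) =
        (if j = i + m then F j else 0) + (if j = i - m then F j else 0) := by
      intro j
      have e1 : j - i = m ↔ j = i + m := by rw [sub_eq_iff_eq_add, add_comm]
      have e2 : j - i = -m ↔ j = i - m := by rw [sub_eq_iff_eq_add, neg_add_eq_sub]
      simp only [e1, e2]
      by_cases h1 : j = i + m
      · have h2 : j ≠ i - m := by
          intro h2
          rw [h1, sub_eq_add_neg] at h2
          exact hm2 (add_left_cancel h2)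
        rw [if_pos (Or.inl h1), if_pos h1, if_neg h2, add_zero]
      · simp [h1]
    simp [this, Finset.sum_add_distrib]
  have hainv : ∀ i : ZMod (2 * n), (a i : QuaternionGroup n)⁻¹ = a (-i) := fun _ => rfl
  have hxinv : ∀ i : ZMod (2 * n), (xa i : QuaternionGroup n)⁻¹ = xa ((n : ZMod (2 * n)) + i) := fun _ => rfl
  have hnn := natCast_add_natCast_self n
  constructor <;> intro i
  · simp only [Matrix.mulVec, dotProduct, QuaternionGroup.sum_eq, SimpleGraph.adjMatrix_apply,
      cayleyGraph_connectionSet_adj hm, hainv, a_mul_a, xa_mul_a, a_mem_connectionSet,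
      xa_mem_connectionSet, ← sub_eq_add_neg, ite_mul, one_mul, zero_mul, if_true, key]
  · have e : ∀ j, (n : ZMod (2 * n)) + ((n : ZMod (2 * n)) + i) - j = i - j := by
      intro j
      rw [← add_assoc, hnn, zero_add]
    have e' : ∀ j : ZMod (2 * n), (i - j = m ∨ i - j = -m) ↔ (j - i = m ∨ j - i = -m) := by
      intro j
      rw [← neg_sub j i, neg_inj, neg_eq_iff_eq_neg, or_comm]
    simp only [Matrix.mulVec, dotProduct, QuaternionGroup.sum_eq, SimpleGraph.adjMatrix_apply,
      cayleyGraph_connectionSet_adj hm, hxinv, a_mul_xa, xa_mul_xa, a_mem_connectionSet,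
      xa_mem_connectionSet, e, e', ite_mul, one_mul, zero_mul, if_true, key]
    rw [add_comm]

open Classical in
theorem adjMatrix_mulVec_charVec [NeZero n] (hm : (m : ZMod (2 * n)) ≠ 0)
    (hm2 : (m : ZMod (2 * n)) ≠ -m) {j : ZMod (2 * n)} (hj : j ≠ 0) :
    ((cayleyGraph (connectionSet n m)).adjMatrix ℂ).mulVec (charVec j) =
      ((ZMod.stdAddChar ((m : ZMod (2 * n)) * j) : ℂ) + (ZMod.stdAddChar ((m : ZMod (2 * n)) * j) : ℂ)⁻¹) • charVec j := by
  have h := adjMatrix_mulVec hm hm2 (charVec j)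
  ext (i | i)
  · rw [h.1]
    simp only [charVec, Pi.smul_apply, smul_eq_mul, Finset.sum_const_zero, add_zero]
    rw [add_mul, sub_mul, AddChar.map_add_eq_mul, AddChar.map_sub_eq_div]
    ring
  · rw [h.2]
    simp only [charVec, Pi.smul_apply, smul_eq_mul, add_zero, mul_zero, zero_add]
    -- Each vertex off `⟨a⟩` is adjacent to all of `⟨a⟩`, where a nontrivial character sums to zero.
    rw [AddChar.sum_mulShift _ (ZMod.isPrimitive_stdAddChar _)]
    simp [hj]

open Classical in
theorem adjMatrix_mulVec_cosetVec [NeZero n] (hm : (m : ZMod (2 * n)) ≠ 0)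
    (hm2 : (m : ZMod (2 * n)) ≠ -m) {c : ℂ} (hc : c * c = 1) :
    ((cayleyGraph (connectionSet n m)).adjMatrix ℂ).mulVec (cosetVec c) =
      (2 + c * (2 * n)) • cosetVec c := by
  have h := adjMatrix_mulVec hm hm2 (cosetVec c)
  ext (i | i)
  · rw [h.1]
    simp [cosetVec, ZMod.card]
    ring
  · rw [h.2]
    simp [cosetVec, ZMod.card]
    linear_combination (-2 * (n : ℂ)) * hc

open Classical in
theorem transitionMatrix_mulVec_of_mulVec_eq_smul {V : Type*} [Fintype V] {Γ : SimpleGraph V}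
    {v : V → ℂ} {c : ℂ} (h : (Γ.adjMatrix ℂ).mulVec v = c • v) (τ : ℝ) :
    (transitionMatrix Γ τ).mulVec v = Complex.exp (Complex.I * τ * c) • v := by
  unfold transitionMatrix
  apply Matrix.exp_mulVec_of_mulVec_eq_smul
  rw [Matrix.smul_mulVec, h, smul_smul]

theorem transitionMatrix_mulVec_single [NeZero n] (hm : (m : ZMod (2 * n)) ≠ 0)
    (hm2 : (m : ZMod (2 * n)) ≠ -m) (τ : ℝ) :
    (transitionMatrix (cayleyGraph (connectionSet n m)) τ).mulVec (Pi.single (a 0) 1) =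
      (2 * n : ℂ)⁻¹ • (∑ j ∈ Finset.univ.erase (0 : ZMod (2 * n)),
        Complex.exp (Complex.I * τ *
          ((ZMod.stdAddChar ((m : ZMod (2 * n)) * j) : ℂ) + (ZMod.stdAddChar ((m : ZMod (2 * n)) * j) : ℂ)⁻¹)) • charVec j +
        (2 : ℂ)⁻¹ • (Complex.exp (Complex.I * τ * (2 + 1 * (2 * n))) • cosetVec 1 +
          Complex.exp (Complex.I * τ * (2 + -1 * (2 * n))) • cosetVec (-1))) := by
  have h0 : (Pi.single (a 0) 1 : QuaternionGroup n → ℂ) =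
      (2 * n : ℂ)⁻¹ • (∑ j ∈ Finset.univ.erase (0 : ZMod (2 * n)), charVec j +
        (2 : ℂ)⁻¹ • (cosetVec 1 + cosetVec (-1))) := by
    have := sum_stdAddChar_smul_charVec (n := n) 0
    simp only [zero_mul, AddChar.map_zero_eq_one, one_smul, neg_zero] at this
    rw [← this, cosetVec_add_cosetVec_neg, smul_smul, inv_mul_cancel₀ two_ne_zero, one_smul,
      Finset.sum_erase_add _ _ (Finset.mem_univ _)]
  rw [h0, Matrix.mulVec_smul, Matrix.mulVec_add, Matrix.mulVec_smul, Matrix.mulVec_add,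
    Matrix.mulVec_sum,
    transitionMatrix_mulVec_of_mulVec_eq_smul (adjMatrix_mulVec_cosetVec hm hm2 (by norm_num)),
    transitionMatrix_mulVec_of_mulVec_eq_smul (adjMatrix_mulVec_cosetVec hm hm2 (by norm_num))]
  congr 2
  exact Finset.sum_congr rfl fun j hj => transitionMatrix_mulVec_of_mulVec_eq_smul
    (adjMatrix_mulVec_charVec hm hm2 (Finset.ne_of_mem_erase hj)) τ

/-! ### Frequencies, phases and their integral relations -/

/-- For odd `q`, the number `-exp (π i / q)` is a primitive root of unity of order `q`. -/
theorem isPrimitiveRoot_neg_exp {q : ℕ} (hodd : Odd q) :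
    IsPrimitiveRoot (-Complex.exp (Real.pi * Complex.I / q)) q := by
  obtain ⟨r, hr⟩ := hodd
  have hq : q ≠ 0 := by omega
  have hqC : (q : ℂ) ≠ 0 := by exact_mod_cast hq
  -- Since `2 * (r + 1) = q + 1`, the power `r + 1` of `exp (2 π i / q)` is `exp (π i + π i / q)`.
  have h := (Complex.isPrimitiveRoot_exp q hq).pow_of_coprime (r + 1) (by
    rw [hr, show 2 * r + 1 = r + (r + 1) by ring, Nat.coprime_add_self_right]
    simp)
  convert h using 1
  rw [← Complex.exp_nat_mul, ← Complex.exp_add_pi_mul_I]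
  congr 1
  have hr' : (q : ℂ) = 2 * r + 1 := by exact_mod_cast hr
  field_simp
  push_cast
  rw [hr']
  ring

section

variable (p q n : ℕ)

/-- The eigenvalues `2 cos (π j / q)`, together with `2 n` and `0`. -/
noncomputable def freq : Option (Option (ZMod (2 * n))) → ℝ
  | none => 0
  | some none => 2 * n
  | some (some j) => 2 * Real.cos (Real.pi * j.val / q)

/-- The limit phases `± 2 π / p`, with the sign given by the parity of `j`. -/
noncomputable def phase : Option (Option (ZMod (2 * n))) → ℝ
  | none => 0
  | some none => 0
  | some (some j) => (-1) ^ j.val * (2 * Real.pi / p)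

end

/-- The signs `(-1) ^ j` in the phases match those relating `2 cos (π j / q)` to `η ^ j + η ^ (-j)`.
The total phase is thus `2 π / p` times an integer divisible by `p`. -/
theorem exp_sum_phase_eq_one {p t n : ℕ} [NeZero n] (hp : p.Prime) (hodd : Odd p) (ht : 1 ≤ t)
    (hpn : p ∣ n) (l : Option (Option (ZMod (2 * n))) → ℤ)
    (h : ∑ i, (l i : ℝ) * freq (p ^ t) n i = 0) :
    Complex.exp (Complex.I * ∑ i, (l i : ℂ) * phase p n i) = 1 := by
  set η : ℂ := -Complex.exp (Real.pi * Complex.I / (p ^ t : ℕ)) with hη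
  have hpow : ∀ k : ℕ, η ^ k + (η ^ k)⁻¹ =
      (-1) ^ k * ((2 * Real.cos (Real.pi * k / (p ^ t : ℕ)) : ℝ) : ℂ) := by
    intro k
    have h1 : η ^ k = (-1) ^ k * Complex.exp ((Real.pi * k / (p ^ t : ℕ) : ℝ) * Complex.I) := by
      rw [hη, neg_pow, ← Complex.exp_nat_mul]
      congr 2
      push_cast
      ring
    have h2 : ((-1 : ℂ) ^ k)⁻¹ = (-1) ^ k := by
      rw [← inv_pow, inv_neg_one]
    rw [h1, mul_inv, h2, ← Complex.exp_neg, ← mul_add, Complex.ofReal_mul, Complex.ofReal_cos,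
      Complex.ofReal_ofNat, Complex.two_cos, neg_mul]
  have hdvd : (p : ℤ) ∣ ∑ j : ZMod (2 * n), l (some (some j)) * (-1) ^ j.val := by
    refine (isPrimitiveRoot_neg_exp (hodd.pow (n := t))).dvd_sum_of_sum_add_inv_eq_zero hp hodd ht
      (fun j : ZMod (2 * n) => j.val) _ (c := l (some none) * (2 * n)) ?_ ?_
    · exact ((Int.natCast_dvd_natCast.2 hpn).mul_left 2).mul_left _
    · have hC := congrArg (fun y : ℝ => (y : ℂ)) h
      simp only [Fintype.sum_option, freq, mul_zero, zero_add] at hC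
      rw [← hη]
      simp only [hpow]
      push_cast at hC ⊢
      rw [← hC, add_comm]
      congr 1
      refine Finset.sum_congr rfl fun j _ => ?_
      have : ((-1 : ℂ) ^ j.val) * (-1) ^ j.val = 1 := by
        rw [← mul_pow]
        norm_num
      linear_combination (l (some (some j)) : ℂ) *
        (2 * Complex.cos (Real.pi * j.val / (p : ℂ) ^ t)) * this
  obtain ⟨d, hd⟩ := hdvd
  have hd' := congrArg (fun y : ℤ => (y : ℂ)) hd
  push_cast at hd'
  have hp0 : (p : ℂ) ≠ 0 := by exact_mod_cast hp.ne_zero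
  rw [Complex.exp_eq_one_iff]
  refine ⟨d, ?_⟩
  simp only [Fintype.sum_option, phase]
  push_cast
  simp only [mul_zero, zero_add, ← mul_assoc, ← Finset.sum_mul]
  simp only [mul_div_assoc, ← mul_assoc]
  rw [hd']
  field_simp

theorem stdAddChar_natCast_mul [NeZero n] (k : ℕ) (j : ZMod (2 * n)) :
    ZMod.stdAddChar ((k : ZMod (2 * n)) * j) =
      Complex.exp (((Real.pi * k * j.val / n : ℝ) : ℂ) * Complex.I) := by
  have hn : (n : ℂ) ≠ 0 := by exact_mod_cast NeZero.ne n
  have h : (k : ZMod (2 * n)) * j = ((k * j.val : ℤ) : ZMod (2 * n)) := by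
    push_cast
    rw [ZMod.natCast_zmod_val]
  rw [h, ZMod.stdAddChar_coe]
  congr 1
  push_cast
  field_simp

theorem stdAddChar_add_inv_eq_freq {n m q : ℕ} [NeZero n] (hn : n = q * m) (j : ZMod (2 * n)) :
    (ZMod.stdAddChar ((m : ZMod (2 * n)) * j) : ℂ) +
      (ZMod.stdAddChar ((m : ZMod (2 * n)) * j) : ℂ)⁻¹ = freq q n (some (some j)) := by
  have hm : (m : ℝ) ≠ 0 := by
    rintro h
    rw [Nat.cast_eq_zero] at h
    exact NeZero.ne n (by rw [hn, h, mul_zero])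
  have harg : Real.pi * m * j.val / n = Real.pi * j.val / q := by
    have hn' : (n : ℝ) = q * m := by exact_mod_cast hn
    rw [hn', mul_right_comm, mul_div_mul_right _ _ hm]
  rw [stdAddChar_natCast_mul, harg, ← Complex.exp_neg]
  simp only [freq]
  rw [Complex.ofReal_mul, Complex.ofReal_cos, Complex.ofReal_ofNat, Complex.two_cos, neg_mul]

theorem stdAddChar_self_mul {n : ℕ} [NeZero n] (j : ZMod (2 * n)) :
    (ZMod.stdAddChar ((n : ZMod (2 * n)) * j) : ℂ) = (-1) ^ j.val := by
  have hn : (n : ℝ) ≠ 0 := by exact_mod_cast NeZero.ne n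
  rw [stdAddChar_natCast_mul, mul_right_comm, mul_div_cancel_right₀ _ hn, ← Complex.exp_pi_mul_I,
    ← Complex.exp_nat_mul]
  congr 1
  push_cast
  ring

theorem exp_phase {p n : ℕ} [NeZero n] (j : ZMod (2 * n)) :
    Complex.exp (Complex.I * phase p n (some (some j))) =
      Real.cos (2 * Real.pi / p) + Complex.I * Real.sin (2 * Real.pi / p) *
        ZMod.stdAddChar ((n : ZMod (2 * n)) * j) := by
  rw [stdAddChar_self_mul, mul_comm Complex.I, Complex.exp_mul_I, phase]
  rcases neg_one_pow_eq_or ℝ j.val with h | h <;>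
    rcases neg_one_pow_eq_or ℂ j.val with h' | h'
  all_goals first
    | (exfalso
       have := congrArg (fun y : ℝ => (y : ℂ)) h
       push_cast at this
       rw [h'] at this
       norm_num at this
       done)
    | (rw [h, h']
       push_cast
       simp only [neg_mul, one_mul, Complex.cos_neg, Complex.sin_neg]
       ring)

/-! ### Choice of the times and the limit state -/

theorem exists_times_tendsto {p t n : ℕ} [NeZero n] (hp : p.Prime) (hodd : Odd p) (ht : 1 ≤ t)
    (hpn : p ∣ n) :
    ∃ τ : ℕ → ℝ, ∀ i, Tendsto (fun k => Complex.exp (Complex.I * (τ k * freq (p ^ t) n i))) atTop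
      (𝓝 (Complex.exp (Complex.I * phase p n i))) := by
  have h : ∀ k : ℕ, ∃ τ : ℝ, ∀ i, ‖Complex.exp (Complex.I * (τ * freq (p ^ t) n i)) -
      Complex.exp (Complex.I * phase p n i)‖ < 1 / ((k : ℝ) + 1) := fun k =>
    kronecker_approximation (o := none) rfl rfl (exp_sum_phase_eq_one hp hodd ht hpn)
      (by positivity)
  choose τ hτ using h
  refine ⟨τ, fun i => ?_⟩
  rw [tendsto_iff_norm_sub_tendsto_zero]
  exact squeeze_zero (fun _ => norm_nonneg _) (fun k => (hτ k i).le)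
    tendsto_one_div_add_atTop_nhds_zero_nat

theorem sin_two_pi_div_ne_zero {p : ℕ} (hp : 3 ≤ p) : Real.sin (2 * Real.pi / p) ≠ 0 := by
  have hp' : (3 : ℝ) ≤ p := by exact_mod_cast hp
  refine (Real.sin_pos_of_pos_of_lt_pi (by positivity) ?_).ne'
  rw [div_lt_iff₀ (by linarith)]
  nlinarith [Real.pi_pos]

theorem sum_exp_phase_smul_charVec (p : ℕ) {n : ℕ} [NeZero n] :
    (2 * n : ℂ)⁻¹ • ∑ j : ZMod (2 * n),
        Complex.exp (Complex.I * phase p n (some (some j))) • charVec j =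
      (Real.cos (2 * Real.pi / p) : ℂ) • Pi.single (a 0) (1 : ℂ) +
        (Complex.I * Real.sin (2 * Real.pi / p)) • Pi.single (a n) (1 : ℂ) := by
  have h0 := sum_stdAddChar_smul_charVec (n := n) 0
  have hn := sum_stdAddChar_smul_charVec (n := n) n
  rw [neg_eq_of_add_eq_zero_left (natCast_add_natCast_self n)] at hn
  simp only [zero_mul, AddChar.map_zero_eq_one, one_smul, neg_zero] at h0
  rw [← h0, ← hn, smul_comm (Real.cos _ : ℂ), smul_comm (Complex.I * _), ← smul_add]
  congr 1
  rw [Finset.smul_sum, Finset.smul_sum, ← Finset.sum_add_distrib]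
  refine Finset.sum_congr rfl fun j _ => ?_
  rw [exp_phase, add_smul, mul_smul]

theorem tendsto_transitionMatrix_mulVec_single {p t n m : ℕ} [NeZero n]
    (hm : (m : ZMod (2 * n)) ≠ 0) (hm2 : (m : ZMod (2 * n)) ≠ -m) (hn : n = p ^ t * m)
    {τ : ℕ → ℝ}
    (hτ : ∀ i, Tendsto (fun k => Complex.exp (Complex.I * (τ k * freq (p ^ t) n i))) atTop
      (𝓝 (Complex.exp (Complex.I * phase p n i)))) :
    Tendsto (fun k => (transitionMatrix (cayleyGraph (connectionSet n m)) (τ k)).mulVec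
      (Pi.single (a 0) 1)) atTop
      (𝓝 ((Real.cos (2 * Real.pi / p) : ℂ) • Pi.single (a 0) 1 +
        (Complex.I * Real.sin (2 * Real.pi / p)) • Pi.single (a n) 1 : QuaternionGroup n → ℂ)) := by
  set z : ZMod (2 * n) → ℂ := fun j => Complex.exp (Complex.I * phase p n (some (some j)))
  have hchar : ∀ j, Tendsto (fun k => Complex.exp (Complex.I * τ k *
      ((ZMod.stdAddChar ((m : ZMod (2 * n)) * j) : ℂ) +
        (ZMod.stdAddChar ((m : ZMod (2 * n)) * j) : ℂ)⁻¹))) atTop (𝓝 (z j)) := by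
    intro j
    simp only [stdAddChar_add_inv_eq_freq hn, mul_assoc]
    exact hτ (some (some j))
  have hzero : (freq (p ^ t) n (some (some 0)) : ℂ) = 2 := by
    simp [freq]
  have hplus : Tendsto (fun k => Complex.exp (Complex.I * τ k * (2 + 1 * (2 * n)))) atTop
      (𝓝 (z 0)) := by
    -- The frequency `2 + 2 n` is the sum of the frequency `2` at `j = 0` and of `2 n`, whose phase
    -- is `0`; so `2 ± 2 n` share the limit `z 0`.
    have h := (hτ (some (some 0))).mul (hτ (some none))
    simp only [← Complex.exp_add, hzero] at h
    convert h using 2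
    · simp only [freq]
      push_cast
      ring_nf
    · simp [z, phase]
  have hminus : Tendsto (fun k => Complex.exp (Complex.I * τ k * (2 + -1 * (2 * n)))) atTop
      (𝓝 (z 0)) := by
    have h := (hτ (some (some 0))).mul ((hτ (some none)).inv₀ (Complex.exp_ne_zero _))
    simp only [← Complex.exp_neg, ← Complex.exp_add, hzero] at h
    convert h using 2
    · simp only [freq]
      push_cast
      ring_nf
    · simp [z, phase]
  have hlim : (2 * n : ℂ)⁻¹ • (∑ j ∈ Finset.univ.erase (0 : ZMod (2 * n)), z j • charVec j +
      (2 : ℂ)⁻¹ • (z 0 • cosetVec 1 + z 0 • cosetVec (-1))) =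
      (Real.cos (2 * Real.pi / p) : ℂ) • Pi.single (a 0) 1 +
        (Complex.I * Real.sin (2 * Real.pi / p)) • Pi.single (a n) 1 := by
    rw [← sum_exp_phase_smul_charVec, ← smul_add, cosetVec_add_cosetVec_neg, smul_comm (z 0),
      smul_smul, inv_mul_cancel₀ two_ne_zero, one_smul,
      Finset.sum_erase_add _ _ (Finset.mem_univ _)]
  rw [← hlim]
  simp only [transitionMatrix_mulVec_single hm hm2]
  exact ((tendsto_finsetSum _ fun j _ => (hchar j).smul_const _).add
    (((hplus.smul_const _).add (hminus.smul_const _)).const_smul _)).const_smul _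

end PGFR

theorem mainTheorem6 (p t m n : ℕ) [NeZero n] (hp : p.Prime) (hodd : Odd p) (ht : 1 ≤ t)
    (hm : 1 ≤ m) (hn : n = p ^ t * m) :
    PGFR.AdmitsPGFR (PGFR.cayleyGraph (PGFR.connectionSet n m)) := by
  have hp3 : 3 ≤ p := by
    have := hp.two_le
    obtain ⟨r, hr⟩ := hodd
    omega
  have hpq : p ≤ p ^ t := Nat.le_self_pow (by omega) p
  have hlt : 2 * m < 2 * n := by
    rw [hn]
    nlinarith
  have hpn : p ∣ n := hn ▸ (dvd_pow_self p (by omega)).mul_right m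
  have hcast : ∀ k : ℕ, 0 < k → k < 2 * n → (k : ZMod (2 * n)) ≠ 0 := by
    intro k hk hkn h
    rw [ZMod.natCast_eq_zero_iff] at h
    exact absurd (Nat.le_of_dvd hk h) (not_le.2 hkn)
  have hm2 : (m : ZMod (2 * n)) ≠ -m := by
    intro h
    refine hcast (m + m) (by omega) (by omega) ?_
    push_cast
    exact eq_neg_iff_add_eq_zero.1 h
  obtain ⟨τ, hτ⟩ := PGFR.exists_times_tendsto hp hodd ht hpn
  refine ⟨QuaternionGroup.a 0, QuaternionGroup.a n, ?_, τ,
    Real.cos (2 * Real.pi / p), Complex.I * Real.sin (2 * Real.pi / p), ?_, ?_, ?_⟩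
  · intro h
    exact hcast n (by omega) (by omega) (QuaternionGroup.a.inj h).symm
  · rw [norm_mul, Complex.norm_I, one_mul, Complex.norm_real, Complex.norm_real, Real.norm_eq_abs,
      Real.norm_eq_abs, sq_abs, sq_abs, Real.cos_sq_add_sin_sq]
  · exact mul_ne_zero Complex.I_ne_zero
      (Complex.ofReal_ne_zero.2 (PGFR.sin_two_pi_div_ne_zero hp3))
  · convert PGFR.tendsto_transitionMatrix_mulVec_single (hcast m (by omega) (by omega)) hm2 hn hτ
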